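/- Throughout, $\mathbb{N}=\{1,2,3,\dots\}$, and a continued fraction $\frac{a_1}{b_1+\frac{a_2}{b_2+\cdots}}$ means the limit of its approximants $A_n/B_n$, with the convention that it terminates just before the first vanishing partial numerator $a_N$ (so its value is then $A_{N-1}/B_{N-1}$). Write $\mathop{\mathrm{K}}_{n=1}^{m}(c_n/d_n)=\frac{c_1}{d_1+\frac{c_2}{d_2+\cdots}}$ for the continued fraction with $m\le\infty$ levels; it is $0$ if $m=0$. Theorem 2. Let $a,b\in\mathbb{R}$ and put $$F(x)=\cfrac{1}{x+\omega+\mathop{\mathrm{K}}_{n=1}^{\infty}\left(\frac{\kappa_n}{x+\omega}\right)},\qquad \omega=\frac{a-1}{2},\qquad \kappa_n=\frac{n^2(n^2+4b-a^2)}{4(2n-1)(2n+1)}.$$ (i) Let $n_0$ be a non-negative integer that is larger than every integer root $\alpha$ of $\alpha^2+a\alpha+b=0$. If either $\sqrt{a^2-4b}\in\mathbb{N}$ or $n_0>\frac{1-a}{2}$, then the series below and the continued fraction $F(n_0)$ converge, and $$\sum_{n=n_0}^{\infty}\frac{1}{n^2+an+b}=F(n_0).$$ (ii) Suppose that $b=\frac{a^2-k^2}{4}$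 with $k\in\mathbb{N}$. Then for every non-negative integer $n_0$ that is larger than each of those numbers $\frac{-a+k}{2},\frac{-a-k}{2}$ that are integers, the series converges and $$\sum_{n=n_0}^{\infty}\frac{1}{n^2+an+b}=\cfrac{1}{n_0+\frac{a-1}{2}+\mathop{\mathrm{K}}_{n=1}^{k-1}\left(\frac{\frac{n^2(n^2-k^2)}{4(2n-1)(2n+1)}}{n_0+\frac{a-1}{2}}\right)},$$ where the right-hand side is the quotient $A_k/B_k$ of the continuants of the whole fraction (of its $k$-th numerator and denominator), and $B_k\neq 0$. Hence the sum has a simple closed form: there are polynomials $P,Q$ with real coefficients, depending only on $a$ and $k$, such that for every such $n_0$ one has $Q(n_0)\ne0$ and the sum equals $P(n_0)/Q(n_0)$. -/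

import Mathlib

open Filter Topology

noncomputable section

open Classical in
/-- The generalized continued fraction
`h + a 0 / (b 0 + a 1 / (b 1 + a 2 / (b 2 + ⋯)))`,
with the convention that it terminates just before the first vanishing partial numerator. -/
def contFrac (h : ℝ) (a b : ℕ → ℝ) : GenContFract ℝ where
  h := h
  s := ⟨fun n => if ∀ i ≤ n, a i ≠ 0 then some ⟨a n, b n⟩ else none, by
    intro n hn
    have h1 : ¬ ∀ i ≤ n, a i ≠ 0 := by
      intro hc
      simp only [if_pos hc] at hn
      exact absurd hn (by simp)
    have h2 : ¬ ∀ i ≤ n + 1, a i ≠ 0 := fun hc => h1 fun i hi => hc i (Nat.le_succ_of_le hi)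
    exact if_neg h2⟩

/-- The continued fraction `g` has the (finite) value `τ`: its approximants
`Aₙ / Bₙ` are eventually genuine quotients (`Bₙ ≠ 0`) and they tend to `τ`.
For a terminating continued fraction the approximants are eventually constant, equal to the
last one. -/
def HasContFracValue (g : GenContFract ℝ) (τ : ℝ) : Prop :=
  (∀ᶠ n in atTop, g.dens n ≠ 0) ∧ Tendsto g.convs atTop (𝓝 τ)

/-- The partial numerators `1, c 1, c 2, c 3, …`. -/
def partialNums (c : ℕ → ℝ) : ℕ → ℝ
  | 0 => 1
  | n + 1 => c (n + 1)

/-- The continued fraction `1 / (y + K_{n ≥ 1} (c n / y))`. Its approximant of index `k ≥ 1` is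
`1 / (y + K_{n = 1}^{k - 1} (c n / y))`. -/
def recipContFrac (c : ℕ → ℝ) (y : ℝ) : GenContFract ℝ :=
  contFrac 0 (partialNums c) (fun _ => y)

/-- `ω = (a - 1) / 2`. -/
def omegaShift (a : ℝ) : ℝ := (a - 1) / 2

/-- `κ_n = n² (n² + 4 b - a²) / (4 (2 n - 1) (2 n + 1))`. -/
def kappa (a b : ℝ) (n : ℕ) : ℝ :=
  (n : ℝ) ^ 2 * ((n : ℝ) ^ 2 + 4 * b - a ^ 2) / (4 * (2 * (n : ℝ) - 1) * (2 * (n : ℝ) + 1))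

/-- The continued fraction `F(a, b; x) = 1 / (x + ω + K_{n ≥ 1} (κ_n / (x + ω)))`. -/
def contFracF (a b x : ℝ) : GenContFract ℝ :=
  recipContFrac (kappa a b) (x + omegaShift a)

/-- The `j`-th term (`j = 0, 1, 2, …`) of the series `∑_{n ≥ n₀} 1 / (n² + a n + b)`. -/
def seriesTerm (a b : ℝ) (n₀ j : ℕ) : ℝ :=
  1 / (((n₀ + j : ℕ) : ℝ) ^ 2 + a * ((n₀ + j : ℕ) : ℝ) + b)

end

/-! Put y = n₀ + (a-1)/2, D = a² - 4b and q(y) = (y+1/2)² - D/4, so that the series is ∑ 1/q(y+j).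
The continuants A_n, B_n solve a three-term recurrence in n, and a first-order operator in n carries
solutions at y+1 to solutions at y, sending B_n F - A_n to q(y)(B_n (F + 1/q(y)) - A_n)
(`shiftedQuad_mul_contDen`, `shiftedQuad_mul_contNum`). So the value should satisfy F(y) = F(y+1) +
1/q(y), and the series telescopes once F vanishes at infinity.

If D = k² with k ≥ 1, this relation closes up on the k-th approximant, a rational function tending
to 0 (`tendsto_sum_of_sq`).

Otherwise y > 0, and the partial numerators are eventually positive. A number F whose remainders B_n
F - A_n alternate in sign from some index on is the limit of the approximants
(`AlternatingRemainder.tendsto`). Alternation survives the backward shift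
(`AlternatingRemainder.backward`), and for large y such an F exists near 0. Shifted back m steps, it
shows that the value at y is the m-th partial sum plus a small error. -/

noncomputable section

open Polynomial in
/-- The numerators of the continued fraction `1 / (X + K_{n ≥ 1} (c n / X))`. -/
def numPoly (c : ℕ → ℝ) : ℕ → Polynomial ℝ
  | 0 => 0
  | 1 => 1
  | n + 2 => X * numPoly c (n + 1) + C (c (n + 1)) * numPoly c n

open Polynomial in
/-- The denominators of the continued fraction `1 / (X + K_{n ≥ 1} (c n / X))`. -/
def denPoly (c : ℕ → ℝ) : ℕ → Polynomial ℝ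
  | 0 => 1
  | 1 => X
  | n + 2 => X * denPoly c (n + 1) + C (c (n + 1)) * denPoly c n

/-- The value at `y` of the `n`-th numerator of `1 / (X + K_{n ≥ 1} (c n / X))`. -/
def contNum (c : ℕ → ℝ) (y : ℝ) (n : ℕ) : ℝ := (numPoly c n).eval y

/-- The value at `y` of the `n`-th denominator of `1 / (X + K_{n ≥ 1} (c n / X))`. -/
def contDen (c : ℕ → ℝ) (y : ℝ) (n : ℕ) : ℝ := (denPoly c n).eval y

end

/-! ### Continuants as polynomials and as library numerators and denominators -/

section Continuants

variable (c : ℕ → ℝ) (y : ℝ)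

@[simp] lemma contNum_zero : contNum c y 0 = 0 := by simp [contNum, numPoly]

@[simp] lemma contNum_one : contNum c y 1 = 1 := by simp [contNum, numPoly]

lemma contNum_add_two (n : ℕ) :
    contNum c y (n + 2) = y * contNum c y (n + 1) + c (n + 1) * contNum c y n := by
  simp [contNum, numPoly]

@[simp] lemma contDen_zero : contDen c y 0 = 1 := by simp [contDen, denPoly]

@[simp] lemma contDen_one : contDen c y 1 = y := by simp [contDen, denPoly]

lemma contDen_add_two (n : ℕ) :
    contDen c y (n + 2) = y * contDen c y (n + 1) + c (n + 1) * contDen c y n := by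
  simp [contDen, denPoly]

/-- Determinant formula: each step multiplies the Casoratian by `-c (n + 1)`, starting from -1. -/
lemma contNum_mul_contDen_sub_ne_zero {n : ℕ} (hc : ∀ i, 1 ≤ i → i ≤ n → c i ≠ 0) :
    contNum c y n * contDen c y (n + 1) - contNum c y (n + 1) * contDen c y n ≠ 0 := by
  induction n with
  | zero => simp
  | succ n ih =>
    have h := mul_ne_zero (neg_ne_zero.2 (hc (n + 1) (by omega) le_rfl))
      (ih fun i h1 h2 => hc i h1 (by omega))
    rw [contDen_add_two, contNum_add_two]
    convert h using 1
    ring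

open Polynomial in
lemma degree_C_mul_le_degree (r : ℝ) (p : ℝ[X]) : (C r * p).degree ≤ p.degree :=
  (degree_mul_le _ _).trans ((add_le_add_left degree_C_le _).trans_eq (zero_add _))

open Polynomial in
lemma degree_denPoly_monic (n : ℕ) : (denPoly c n).degree = n ∧ (denPoly c n).Monic := by
  induction n using Nat.twoStepInduction with
  | zero => simp [denPoly]
  | one => simp [denPoly, monic_X]
  | more n ih1 ih2 =>
    have hX : (X * denPoly c (n + 1)).degree = ((n + 2 : ℕ) : WithBot ℕ) := by
      rw [degree_mul, degree_X, ih2.1]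
      norm_cast
      omega
    have hlt : (C (c (n + 1)) * denPoly c n).degree < (X * denPoly c (n + 1)).degree := by
      rw [hX]
      refine (degree_C_mul_le_degree _ _).trans_lt ?_
      rw [ih1.1]
      exact_mod_cast (by omega : n < n + 2)
    refine ⟨?_, ?_⟩
    · rw [denPoly, degree_add_eq_left_of_degree_lt hlt, hX]
    · exact (monic_X.mul ih2.2).add_of_left hlt

open Polynomial in
lemma degree_numPoly_lt (n : ℕ) : (numPoly c n).degree < n := by
  induction n using Nat.twoStepInduction with
  | zero => simp [numPoly]
  | one => simp [numPoly]
  | more n ih1 ih2 =>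
    rw [numPoly]
    refine (degree_add_le _ _).trans_lt (max_lt ?_ ?_)
    · by_cases h0 : numPoly c (n + 1) = 0
      · simp only [h0, mul_zero, degree_zero]
        exact WithBot.bot_lt_coe _
      · rw [degree_mul, degree_X, degree_eq_natDegree h0]
        rw [degree_eq_natDegree h0] at ih2
        norm_cast at ih2 ⊢
        omega
    · refine (degree_C_mul_le_degree _ _).trans_lt (ih1.trans ?_)
      exact_mod_cast (by omega : n < n + 2)

lemma tendsto_contNum_div_contDen (n : ℕ) :
    Tendsto (fun y => contNum c y n / contDen c y n) atTop (𝓝 0) :=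
  Polynomial.div_tendsto_atTop_zero_of_degree_lt _ _
    ((degree_denPoly_monic c n).1 ▸ degree_numPoly_lt c n)

lemma eventually_contDen_pos (n : ℕ) : ∀ᶠ y in atTop, 0 < contDen c y n := by
  cases n with
  | zero => simp
  | succ n =>
    refine (Polynomial.tendsto_atTop_of_leadingCoeff_nonneg (denPoly c (n + 1)) ?_ ?_)
      |>.eventually_gt_atTop 0
    · rw [(degree_denPoly_monic c _).1]
      exact_mod_cast n.succ_pos
    · rw [(degree_denPoly_monic c _).2.leadingCoeff]
      exact zero_le_one

lemma recipContFrac_get? {k n : ℕ} (hc : ∀ i, 1 ≤ i → i < k → c i ≠ 0) (hn : n < k) :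
    (recipContFrac c y).s.get? n = some ⟨partialNums c n, y⟩ := by
  refine if_pos fun i hi => ?_
  cases i with
  | zero => exact one_ne_zero
  | succ i => exact hc _ (by omega) (by omega)

lemma recipContFrac_nums_dens {k : ℕ} (hc : ∀ i, 1 ≤ i → i < k → c i ≠ 0) (n : ℕ) :
    n ≤ k → (recipContFrac c y).nums n = contNum c y n ∧
      (recipContFrac c y).dens n = contDen c y n := by
  induction n using Nat.twoStepInduction with
  | zero => exact fun _ => ⟨by simp; rfl, by simp⟩
  | one =>
    intro hk
    have hs := recipContFrac_get? c y hc (show 0 < k by omega)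
    rw [GenContFract.first_num_eq hs, GenContFract.first_den_eq hs]
    have h0 : (recipContFrac c y).h = 0 := rfl
    simp [h0, partialNums]
  | more n ih1 ih2 =>
    intro hk
    have hs := recipContFrac_get? c y hc (show n + 1 < k by omega)
    rw [GenContFract.nums_recurrence hs (ih1 (by omega)).1 (ih2 (by omega)).1,
      GenContFract.dens_recurrence hs (ih1 (by omega)).2 (ih2 (by omega)).2,
      contNum_add_two, contDen_add_two]
    exact ⟨rfl, rfl⟩

lemma recipContFrac_terminatedAt {k : ℕ} (hk : 0 < k) (hc : c k = 0) :
    (recipContFrac c y).TerminatedAt k := by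
  refine if_neg fun h => h k le_rfl ?_
  obtain ⟨k, rfl⟩ := Nat.exists_eq_succ_of_ne_zero hk.ne'
  exact hc

end Continuants

/-! ### The discrete Legendre coefficients and the shift y + 1 → y -/

section Gram

/-- The recurrence coefficients `n² (n² - D) / (4 (2 n - 1) (2 n + 1))` of the (generalized)
discrete Legendre polynomials. -/
noncomputable def gramCoeff (D : ℝ) (n : ℕ) : ℝ :=
  (n : ℝ) ^ 2 * ((n : ℝ) ^ 2 - D) / (4 * (2 * (n : ℝ) - 1) * (2 * (n : ℝ) + 1))

lemma kappa_eq_gramCoeff (a b : ℝ) : kappa a b = gramCoeff (a ^ 2 - 4 * b) := by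
  funext n
  rw [kappa, gramCoeff]
  ring

variable (D : ℝ)

lemma four_mul_sub_one_mul_add_one_pos {n : ℕ} (hn : 1 ≤ n) :
    (0 : ℝ) < 4 * (2 * (n : ℝ) - 1) * (2 * (n : ℝ) + 1) := by
  have h : (1 : ℝ) ≤ n := by exact_mod_cast hn
  exact mul_pos (by linarith) (by linarith)

lemma gramCoeff_ne_zero {n : ℕ} (hn : 1 ≤ n) (h : (n : ℝ) ^ 2 ≠ D) : gramCoeff D n ≠ 0 := by
  have h0 : (n : ℝ) ≠ 0 := by exact_mod_cast (by omega : n ≠ 0)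
  exact div_ne_zero (mul_ne_zero (pow_ne_zero 2 h0) (sub_ne_zero.2 h))
    (four_mul_sub_one_mul_add_one_pos hn).ne'

lemma gramCoeff_pos {n : ℕ} (hn : 1 ≤ n) (h : D < (n : ℝ) ^ 2) : 0 < gramCoeff D n := by
  have h0 : (0 : ℝ) < n := by exact_mod_cast hn
  exact div_pos (mul_pos (pow_pos h0 2) (sub_pos.2 h)) (four_mul_sub_one_mul_add_one_pos hn)

lemma gramCoeff_le {n : ℕ} (hn : 1 ≤ n) : gramCoeff D n ≤ ((1 + |D|) * (n : ℝ)) ^ 2 := by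
  have h1 : (1 : ℝ) ≤ n := by exact_mod_cast hn
  rw [gramCoeff, div_le_iff₀ (four_mul_sub_one_mul_add_one_pos hn)]
  have hD := neg_abs_le D
  have hD0 := abs_nonneg D
  have h2 : (n : ℝ) ^ 2 - D ≤ (1 + |D|) ^ 2 * (n : ℝ) ^ 2 := by
    have h5 : (1 : ℝ) ≤ (n : ℝ) ^ 2 := by nlinarith
    have h6 : |D| ≤ |D| * (n : ℝ) ^ 2 := by nlinarith
    nlinarith [mul_nonneg (mul_nonneg hD0 (by linarith : (0 : ℝ) ≤ 1 + |D|)) (sq_nonneg (n : ℝ))]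
  have h3 : (n : ℝ) ^ 2 ≤ 4 * (2 * (n : ℝ) - 1) * (2 * (n : ℝ) + 1) := by nlinarith
  have h4 : 0 ≤ (1 + |D|) ^ 2 * (n : ℝ) ^ 2 := by positivity
  calc (n : ℝ) ^ 2 * ((n : ℝ) ^ 2 - D) ≤ (n : ℝ) ^ 2 * ((1 + |D|) ^ 2 * (n : ℝ) ^ 2) := by gcongr
    _ ≤ (4 * (2 * (n : ℝ) - 1) * (2 * (n : ℝ) + 1)) * ((1 + |D|) ^ 2 * (n : ℝ) ^ 2) := by gcongr
    _ = _ := by ring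

/-- The weighted difference is polynomial in `n`; this is all that `backward_shift_recurrence` needs
to know of the coefficients. -/
lemma gramCoeff_step (n : ℕ) :
    (2 * n + 3) * gramCoeff D (n + 1) =
      (2 * n - 1) * gramCoeff D n + (1 - D) / 4 + n * (n + 1) / 2 := by
  have h1 : (2 * (n : ℝ) - 1) ≠ 0 := by
    intro h
    have : ((2 * n : ℕ) : ℝ) = (1 : ℕ) := by push_cast; linarith
    have := Nat.cast_injective this
    omega
  have h2 : (2 * (n : ℝ) + 1) ≠ 0 := by positivity
  have h3 : (2 * (n : ℝ) + 3) ≠ 0 := by positivity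
  rw [gramCoeff, gramCoeff]
  push_cast
  rw [show 2 * ((n : ℝ) + 1) - 1 = 2 * n + 1 by ring,
    show 2 * ((n : ℝ) + 1) + 1 = 2 * n + 3 by ring]
  field_simp
  ring

/-- The quadratic `n² + a n + b` in terms of `y = n + (a - 1) / 2` and `D = a² - 4 b`. -/
noncomputable def shiftedQuad (y : ℝ) : ℝ := (y + 1 / 2) ^ 2 - D / 4

/-- The diagonal coefficient of the backward shift relations for the continuants. -/
noncomputable def backCoeff (y : ℝ) (n : ℕ) : ℝ :=
  (y + 1) ^ 2 + n * (y + 1) + (1 - D) / 4 + n * (n + 1) / 2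

/-- The backward shift of a solution of the recurrence at `y + 1` is a solution at `y`. -/
lemma backward_shift_recurrence {y : ℝ} {u : ℕ → ℝ} {n : ℕ}
    (h1 : u (n + 2) = (y + 1) * u (n + 1) + gramCoeff D (n + 1) * u n)
    (h2 : u (n + 3) = (y + 1) * u (n + 2) + gramCoeff D (n + 2) * u (n + 1)) :
    backCoeff D y (n + 2) * u (n + 2) - (2 * n + 5) * u (n + 3) =
      y * (backCoeff D y (n + 1) * u (n + 1) - (2 * n + 3) * u (n + 2)) +
        gramCoeff D (n + 1) * (backCoeff D y n * u n - (2 * n + 1) * u (n + 1)) := by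
  have hs := gramCoeff_step D (n + 1)
  push_cast at hs
  simp only [backCoeff]
  push_cast
  rw [h2, h1]
  linear_combination (-u (n + 1)) * hs

/-- Both sides solve the recurrence at `y`, so agreement at n = 0, 1 suffices. -/
lemma shiftedQuad_mul_contDen (y : ℝ) (n : ℕ) :
    shiftedQuad D y * contDen (gramCoeff D) y n =
      backCoeff D y n * contDen (gramCoeff D) (y + 1) n -
        (2 * n + 1) * contDen (gramCoeff D) (y + 1) (n + 1) := by
  induction n using Nat.twoStepInduction with
  | zero => simp [shiftedQuad, backCoeff]; ring
  | one =>
    simp [shiftedQuad, backCoeff, contDen_add_two, gramCoeff]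
    ring
  | more n ih1 ih2 =>
    have h := backward_shift_recurrence D (y := y) (contDen_add_two (gramCoeff D) (y + 1) n)
      (contDen_add_two (gramCoeff D) (y + 1) (n + 1))
    rw [contDen_add_two _ y]
    push_cast at ih2 ⊢
    linear_combination y * ih2 + gramCoeff D (n + 1) * ih1 - h

/-- Same argument; the extra `contDen` term is the source of the summand 1/q(y). -/
lemma shiftedQuad_mul_contNum (y : ℝ) (n : ℕ) :
    shiftedQuad D y * contNum (gramCoeff D) y n - contDen (gramCoeff D) y n =
      backCoeff D y n * contNum (gramCoeff D) (y + 1) n -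
        (2 * n + 1) * contNum (gramCoeff D) (y + 1) (n + 1) := by
  induction n using Nat.twoStepInduction with
  | zero => simp
  | one =>
    simp [shiftedQuad, backCoeff, contNum_add_two]
    ring
  | more n ih1 ih2 =>
    have h := backward_shift_recurrence D (y := y) (contNum_add_two (gramCoeff D) (y + 1) n)
      (contNum_add_two (gramCoeff D) (y + 1) (n + 1))
    rw [contNum_add_two _ y, contDen_add_two _ y]
    push_cast at ih2 ⊢
    linear_combination y * ih2 + gramCoeff D (n + 1) * ih1 - h

end Gram

/-! ### Positive three-term recurrences and alternating solutions -/

section ThreeTerm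

variable {κ : ℕ → ℝ} {y : ℝ}

lemma casoratian_succ {u w : ℕ → ℝ} (hu : ∀ n, u (n + 2) = y * u (n + 1) + κ n * u n)
    (hw : ∀ n, w (n + 2) = y * w (n + 1) + κ n * w n) (n : ℕ) :
    u (n + 1) * w (n + 2) - u (n + 2) * w (n + 1) =
      -κ n * (u n * w (n + 1) - u (n + 1) * w n) := by
  rw [hu, hw]
  ring

lemma three_term_pos (hκ : ∀ n, 0 < κ n) (hy : 0 < y) {w : ℕ → ℝ}
    (hw : ∀ n, w (n + 2) = y * w (n + 1) + κ n * w n) (h0 : 0 < w 0) (h1 : 0 < w 1) (n : ℕ) :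
    0 < w n := by
  induction n using Nat.twoStepInduction with
  | zero => exact h0
  | one => exact h1
  | more n ih1 ih2 =>
    rw [hw]
    have := hκ n
    positivity

/-- The Casoratian alternates in sign, so even quotients u/w increase strictly, odd ones decrease
strictly, and the nested intervals contain a point strictly separating the two families. -/
lemma exists_alternating_of_casoratian_neg (hκ : ∀ n, 0 < κ n) (hy : 0 < y) {u w : ℕ → ℝ}
    (hu : ∀ n, u (n + 2) = y * u (n + 1) + κ n * u n)
    (hw : ∀ n, w (n + 2) = y * w (n + 1) + κ n * w n) (h0 : 0 < w 0) (h1 : 0 < w 1)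
    (hC : u 0 * w 1 - u 1 * w 0 < 0) :
    ∃ F ∈ Set.Icc (u 0 / w 0) (u 1 / w 1),
      ∀ n, (w n * F - u n) * (w (n + 1) * F - u (n + 1)) < 0 := by
  have hpos := three_term_pos hκ hy hw h0 h1
  have hCas : ∀ i, u (2 * i) * w (2 * i + 1) - u (2 * i + 1) * w (2 * i) < 0 ∧
      0 < u (2 * i + 1) * w (2 * i + 2) - u (2 * i + 2) * w (2 * i + 1) := by
    intro i
    induction i with
    | zero =>
      refine ⟨hC, ?_⟩
      rw [casoratian_succ hu hw]
      exact mul_pos_of_neg_of_neg (neg_lt_zero.2 (hκ _)) hC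
    | succ i ih =>
      have h : u (2 * i + 2) * w (2 * i + 3) - u (2 * i + 3) * w (2 * i + 2) < 0 := by
        rw [casoratian_succ hu hw (2 * i + 1)]
        exact mul_neg_of_neg_of_pos (neg_lt_zero.2 (hκ _)) ih.2
      refine ⟨h, ?_⟩
      rw [show 2 * (i + 1) = 2 * i + 2 by ring, casoratian_succ hu hw]
      exact mul_pos_of_neg_of_neg (neg_lt_zero.2 (hκ _)) h
  have heven : ∀ i, u (2 * i) / w (2 * i) < u (2 * (i + 1)) / w (2 * (i + 1)) := by
    intro i
    rw [div_lt_div_iff₀ (hpos _) (hpos _), show 2 * (i + 1) = 2 * i + 2 by ring, hu, hw]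
    nlinarith [mul_neg_of_pos_of_neg hy (hCas i).1]
  have hodd : ∀ i, u (2 * (i + 1) + 1) / w (2 * (i + 1) + 1) < u (2 * i + 1) / w (2 * i + 1) := by
    intro i
    rw [div_lt_div_iff₀ (hpos _) (hpos _), show 2 * (i + 1) + 1 = 2 * i + 1 + 2 by ring, hu, hw]
    nlinarith [mul_pos hy (hCas i).2]
  have hle : ∀ i, u (2 * i) / w (2 * i) ≤ u (2 * i + 1) / w (2 * i + 1) := by
    intro i
    rw [div_le_div_iff₀ (hpos _) (hpos _)]
    linarith [(hCas i).1]
  have hF := Set.mem_iInter.1 (Monotone.ciSup_mem_iInter_Icc_of_antitone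
    (monotone_nat_of_le_succ fun i => (heven i).le)
    (antitone_nat_of_succ_le fun i => (hodd i).le) hle)
  generalize (⨆ i, u (2 * i) / w (2 * i)) = F at hF
  have hE : ∀ i, 0 < w (2 * i) * F - u (2 * i) := by
    intro i
    have := (div_lt_iff₀ (hpos (2 * i))).1 ((heven i).trans_le (hF (i + 1)).1)
    linarith
  have hO : ∀ i, w (2 * i + 1) * F - u (2 * i + 1) < 0 := by
    intro i
    have := (lt_div_iff₀ (hpos (2 * i + 1))).1 ((hF (i + 1)).2.trans_lt (hodd i))
    linarith
  refine ⟨F, hF 0, fun n => ?_⟩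
  obtain ⟨i, rfl | rfl⟩ := n.even_or_odd'
  · exact mul_neg_of_pos_of_neg (hE i) (hO i)
  · exact mul_neg_of_neg_of_pos (hO i) (hE (i + 1))

/-- A three-term recurrence with positive coefficients has, for two independent solutions `u, w`
with `w` positive, an alternating solution `F w - u` with `F` between the first two quotients. -/
lemma exists_alternating (hκ : ∀ n, 0 < κ n) (hy : 0 < y) {u w : ℕ → ℝ}
    (hu : ∀ n, u (n + 2) = y * u (n + 1) + κ n * u n)
    (hw : ∀ n, w (n + 2) = y * w (n + 1) + κ n * w n) (h0 : 0 < w 0) (h1 : 0 < w 1)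
    (hC : u 0 * w 1 - u 1 * w 0 ≠ 0) :
    ∃ F ∈ Set.uIcc (u 0 / w 0) (u 1 / w 1),
      ∀ n, (w n * F - u n) * (w (n + 1) * F - u (n + 1)) < 0 := by
  rcases hC.lt_or_gt with hC | hC
  · obtain ⟨F, hF, h⟩ := exists_alternating_of_casoratian_neg hκ hy hu hw h0 h1 hC
    exact ⟨F, Set.Icc_subset_uIcc hF, h⟩
  · obtain ⟨F, hF, h⟩ := exists_alternating_of_casoratian_neg (u := fun n => -u n) hκ hy
      (fun n => by rw [hu]; ring) hw h0 h1 (by linarith)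
    refine ⟨-F, Set.Icc_subset_uIcc' ?_, fun n => ?_⟩
    · rw [neg_div, neg_div] at hF
      exact ⟨by linarith [hF.2], by linarith [hF.1]⟩
    · linarith [h n]

/-- Seidel's criterion: the products of neighbouring terms of a positive solution, divided by the
Casoratian, are unbounded. -/
lemma tendsto_mul_div_casoratian (hκ : ∀ n, 0 < κ n) (hy : 0 < y) {c : ℝ} (hc : 0 < c)
    (hκc : ∀ n, κ n ≤ (c * (n + 1)) ^ 2) {w : ℕ → ℝ}
    (hw : ∀ n, w (n + 2) = y * w (n + 1) + κ n * w n) (hpos : ∀ n, 0 < w n)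
    {p : ℕ → ℝ} (hp : ∀ n, 0 < p n) (hps : ∀ n, p (n + 1) = κ n * p n) :
    Tendsto (fun n => w n * w (n + 1) / p n) atTop atTop := by
  set P : ℕ → ℝ := fun n => w n * w (n + 1) / p n with hP
  set T : ℕ → ℝ := fun n => w n ^ 2 / p n with hT
  have hT0 : ∀ n, 0 < T n := fun n => div_pos (pow_pos (hpos n) 2) (hp n)
  have hP0 : ∀ n, 0 < P n := fun n => div_pos (mul_pos (hpos n) (hpos _)) (hp n)
  -- `P` increases by y T, and the product of neighbouring T's is P²/κ. By AM-GM two consecutive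
  -- increments are at least of order 1/n, so `P` diverges like the harmonic series.
  have hPs : ∀ n, P (n + 1) = P n + y * T (n + 1) := by
    intro n
    have h1 := (hp n).ne'
    have h2 := (hκ n).ne'
    simp only [hP, hT]
    rw [hw, hps]
    field_simp
    ring
  have hmono : Monotone P := monotone_nat_of_le_succ fun n => by
    rw [hPs]
    have := mul_pos hy (hT0 (n + 1))
    linarith
  have hTT : ∀ n, T n * T (n + 1) = P n ^ 2 / κ n := by
    intro n
    have h1 := (hp n).ne'
    have h2 := (hκ n).ne'
    simp only [hP, hT]
    rw [hps]
    field_simp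
  have hlow : ∀ n : ℕ, 2 * P 0 / (c * (n + 1)) ≤ T n + T (n + 1) := by
    intro n
    have hcn : 0 < c * ((n : ℝ) + 1) := by positivity
    refine (abs_le_of_sq_le_sq' ?_ (add_pos (hT0 n) (hT0 _)).le).2
    calc (2 * P 0 / (c * (n + 1))) ^ 2 = 4 * (P 0 ^ 2 / (c * (n + 1)) ^ 2) := by rw [div_pow]; ring
      _ ≤ 4 * (P n ^ 2 / κ n) := by
        have h0 := (hP0 0).le
        have h1 := hmono (Nat.zero_le n)
        have h2 := hκ n
        have h3 := hκc n
        gcongr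
      _ = 4 * (T n * T (n + 1)) := by rw [hTT]
      _ ≤ (T n + T (n + 1)) ^ 2 := by nlinarith [sq_nonneg (T n - T (n + 1))]
  have hsum : ∀ m : ℕ, y * P 0 / c * ∑ i ∈ Finset.range m, (1 / (i + 1) : ℝ) ≤ P (2 * m) := by
    intro m
    induction m with
    | zero => simpa using (hP0 0).le
    | succ m ih =>
      rw [Finset.sum_range_succ, show 2 * (m + 1) = 2 * m + 1 + 1 by ring, hPs, hPs]
      have h := mul_le_mul_of_nonneg_left (hlow (2 * m + 1)) hy.le
      have h2 : y * (2 * P 0 / (c * (((2 * m + 1 : ℕ) : ℝ) + 1))) = y * P 0 / c * (1 / (m + 1)) := by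
        have : (m : ℝ) + 1 ≠ 0 := by positivity
        have hc' := hc.ne'
        push_cast
        rw [show 2 * (m : ℝ) + 1 + 1 = 2 * (m + 1) by ring]
        field_simp
      rw [h2] at h
      linarith
  have hinf : Tendsto (fun m : ℕ => P (2 * m)) atTop atTop := by
    refine tendsto_atTop_mono hsum (Real.tendsto_sum_range_one_div_nat_succ_atTop.const_mul_atTop ?_)
    have := hP0 0
    positivity
  refine tendsto_atTop_atTop_of_monotone hmono fun B => ?_
  obtain ⟨m, hm⟩ := (hinf.eventually_ge_atTop B).exists
  exact ⟨_, hm⟩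

/-- An alternating solution of a three-term recurrence with positive, at most quadratically growing
coefficients is dominated by every independent solution. -/
lemma alternating_div_tendsto_zero (hκ : ∀ n, 0 < κ n) (hy : 0 < y) {c : ℝ} (hc : 0 < c)
    (hκc : ∀ n, κ n ≤ (c * (n + 1)) ^ 2) {v w : ℕ → ℝ}
    (hv : ∀ n, v (n + 2) = y * v (n + 1) + κ n * v n)
    (hw : ∀ n, w (n + 2) = y * w (n + 1) + κ n * w n)
    (halt : ∀ n, v n * v (n + 1) < 0) (hC : v 0 * w 1 - v 1 * w 0 ≠ 0) :
    (∀ᶠ n in atTop, w n ≠ 0) ∧ Tendsto (fun n => v n / w n) atTop (𝓝 0) := by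
  -- `w` may change sign; the combination with both initial values 1 stays positive.
  obtain ⟨l, m, hU0, hU1⟩ : ∃ l m : ℝ, l * w 0 + m * v 0 = 1 ∧ l * w 1 + m * v 1 = 1 := by
    refine ⟨(v 0 - v 1) / (v 0 * w 1 - v 1 * w 0), (w 1 - w 0) / (v 0 * w 1 - v 1 * w 0), ?_, ?_⟩
    · field_simp; ring
    · field_simp; ring
  set U : ℕ → ℝ := fun n => l * w n + m * v n with hUdef
  have hU : ∀ n, U (n + 2) = y * U (n + 1) + κ n * U n := by
    intro n
    simp only [hUdef]
    rw [hv, hw]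
    ring
  have hpos := three_term_pos hκ hy hU (by rw [hUdef]; simp [hU0]) (by rw [hUdef]; simp [hU1])
  -- Otherwise the positive solution `U` would be a multiple of the alternating `v`.
  have hl : l ≠ 0 := by
    rintro rfl
    have h := mul_pos (hpos 0) (hpos 1)
    simp only [hUdef, zero_mul, zero_add] at h
    nlinarith [halt 0, mul_nonneg (sq_nonneg m) (neg_pos.2 (halt 0)).le]
  have hCU : v 0 * U 1 - v 1 * U 0 ≠ 0 := by
    simp only [hUdef]
    convert mul_ne_zero hl hC using 1
    ring
  set p : ℕ → ℝ := fun n => |v n * U (n + 1) - v (n + 1) * U n| with hpdef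
  have hps : ∀ n, p (n + 1) = κ n * p n := by
    intro n
    simp only [hpdef]
    rw [casoratian_succ hv hU, abs_mul, abs_neg, abs_of_pos (hκ n)]
  have hp : ∀ n, 0 < p n := by
    intro n
    induction n with
    | zero => exact abs_pos.2 hCU
    | succ n ih => rw [hps]; exact mul_pos (hκ n) ih
  have hlim := (tendsto_mul_div_casoratian hκ hy hc hκc hU hpos hp hps).inv_tendsto_atTop
  have hg : Tendsto (fun n => v n / U n) atTop (𝓝 0) := by
    refine squeeze_zero_norm (fun n => ?_) hlim
    have h1 := (hpos n)
    have h2 := (hpos (n + 1))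
    have h3 := halt n
    simp only [Pi.inv_apply, inv_div]
    rw [Real.norm_eq_abs, abs_div, abs_of_pos h1, div_le_div_iff₀ h1 (mul_pos h1 h2)]
    -- By alternation the two terms of the Casoratian have the same sign, so neither exceeds it in
    -- absolute value.
    have key : |v n| * U (n + 1) ≤ p n := by
      simp only [hpdef]
      rcases lt_or_ge 0 (v n) with hvn | hvn
      · have hv1 : v (n + 1) < 0 := by
          by_contra hcon
          nlinarith
        rw [abs_of_pos hvn]
        refine le_trans ?_ (le_abs_self _)
        nlinarith
      · have hv1 : 0 < v (n + 1) := by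
          by_contra hcon
          nlinarith
        rw [abs_of_nonpos hvn]
        refine le_trans ?_ (neg_le_abs _)
        nlinarith
    calc |v n| * (U n * U (n + 1)) = (|v n| * U (n + 1)) * U n := by ring
      _ ≤ p n * U n := by gcongr
  have hwU : Tendsto (fun n => w n / U n) atTop (𝓝 (1 / l)) := by
    have h : Tendsto (fun n => (1 - m * (v n / U n)) / l) atTop (𝓝 ((1 - m * 0) / l)) :=
      ((hg.const_mul m).const_sub 1).div_const l
    rw [mul_zero, sub_zero] at h
    refine h.congr fun n => ?_
    have h1 := (hpos n).ne'
    rw [div_eq_div_iff hl h1]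
    field_simp
    simp only [hUdef]
    ring
  have hne := hwU.eventually_ne (one_div_ne_zero hl)
  refine ⟨hne.mono fun n hn h0 => hn (by rw [h0, zero_div]), ?_⟩
  have h := hg.div hwU (one_div_ne_zero hl)
  rw [zero_div] at h
  refine h.congr fun n => ?_
  exact div_div_div_cancel_right₀ (hpos n).ne' _ _

end ThreeTerm

/-! ### The terminating case D = k² -/

section Terminating

lemma gramCoeff_sq_self (k : ℕ) : gramCoeff ((k : ℝ) ^ 2) k = 0 := by simp [gramCoeff]

lemma shiftedQuad_sq (k : ℕ) (y : ℝ) :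
    shiftedQuad ((k : ℝ) ^ 2) y = (y + (1 - k) / 2) * (y + (1 + k) / 2) := by
  rw [shiftedQuad]
  ring

/-- As the k-th coefficient vanishes, B_{k+1} = (y+1) B_k at y+1, and the diagonal factor becomes a
perfect square. -/
lemma shiftedQuad_mul_contDen_self {k : ℕ} (hk : 0 < k) (y : ℝ) :
    shiftedQuad ((k : ℝ) ^ 2) y * contDen (gramCoeff ((k : ℝ) ^ 2)) y k =
      (y + (1 - k) / 2) ^ 2 * contDen (gramCoeff ((k : ℝ) ^ 2)) (y + 1) k := by
  obtain ⟨l, rfl⟩ := Nat.exists_eq_succ_of_ne_zero hk.ne'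
  rw [shiftedQuad_mul_contDen, Nat.succ_eq_add_one, contDen_add_two, gramCoeff_sq_self, backCoeff]
  push_cast
  ring

lemma shiftedQuad_mul_contNum_self {k : ℕ} (hk : 0 < k) (y : ℝ) :
    shiftedQuad ((k : ℝ) ^ 2) y * contNum (gramCoeff ((k : ℝ) ^ 2)) y k -
        contDen (gramCoeff ((k : ℝ) ^ 2)) y k =
      (y + (1 - k) / 2) ^ 2 * contNum (gramCoeff ((k : ℝ) ^ 2)) (y + 1) k := by
  obtain ⟨l, rfl⟩ := Nat.exists_eq_succ_of_ne_zero hk.ne'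
  rw [shiftedQuad_mul_contNum, Nat.succ_eq_add_one, contNum_add_two, gramCoeff_sq_self, backCoeff]
  push_cast
  ring

lemma tendsto_add_natCast_atTop (y : ℝ) : Tendsto (fun m : ℕ => y + (m : ℝ)) atTop atTop :=
  tendsto_atTop_add_const_left _ _ tendsto_natCast_atTop_atTop

/-- A zero at `y` would propagate to every y + m, but the monic B_k is positive far out. -/
lemma contDen_self_ne_zero {k : ℕ} (hk : 0 < k) {y : ℝ} (hq : ∀ j : ℕ, shiftedQuad ((k : ℝ) ^ 2) (y + j) ≠ 0) :
    contDen (gramCoeff ((k : ℝ) ^ 2)) y k ≠ 0 := by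
  intro h0
  have hall : ∀ m : ℕ, contDen (gramCoeff ((k : ℝ) ^ 2)) (y + m) k = 0 := by
    intro m
    induction m with
    | zero => simpa using h0
    | succ m ih =>
      have h := shiftedQuad_mul_contDen_self hk (y + m)
      have hm := hq m
      rw [shiftedQuad_sq] at hm
      rw [ih, mul_zero, eq_comm] at h
      have h2 := (mul_eq_zero.1 h).resolve_left (pow_ne_zero 2 (left_ne_zero_of_mul hm))
      rw [← h2]
      push_cast
      ring_nf
  obtain ⟨m, hm⟩ := ((tendsto_add_natCast_atTop y).eventually
    (eventually_contDen_pos (gramCoeff ((k : ℝ) ^ 2)) k)).exists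
  exact hm.ne' (hall m)

/-- If `D = k²`, the partial sums of `∑ 1 / q (y + i)` tend to the `k`-th approximant. -/
lemma tendsto_sum_of_sq {k : ℕ} (hk : 0 < k) {y : ℝ} (hq : ∀ j : ℕ, shiftedQuad ((k : ℝ) ^ 2) (y + j) ≠ 0) :
    Tendsto (fun m => ∑ i ∈ Finset.range m, 1 / shiftedQuad ((k : ℝ) ^ 2) (y + (i : ℕ))) atTop
      (𝓝 (contNum (gramCoeff ((k : ℝ) ^ 2)) y k / contDen (gramCoeff ((k : ℝ) ^ 2)) y k)) := by
  set f : ℝ → ℝ := fun y =>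
    contNum (gramCoeff ((k : ℝ) ^ 2)) y k / contDen (gramCoeff ((k : ℝ) ^ 2)) y k with hf
  have hB : ∀ m : ℕ, contDen (gramCoeff ((k : ℝ) ^ 2)) (y + m) k ≠ 0 := fun m =>
    contDen_self_ne_zero hk fun j => by
      have := hq (m + j)
      push_cast at this
      rwa [add_assoc]
  -- Eliminating the common square from the two shift relations gives f(y) - f(y+1) = 1/q(y).
  have hstep : ∀ m : ℕ, 1 / shiftedQuad ((k : ℝ) ^ 2) (y + m) = f (y + m) - f (y + (m + 1 : ℕ)) := by
    intro m
    have h1 := shiftedQuad_mul_contDen_self hk (y + m)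
    have h2 := shiftedQuad_mul_contNum_self hk (y + m)
    have b1 := hB m
    have b2 := hB (m + 1)
    have b3 := hq m
    push_cast at b2 ⊢
    rw [← add_assoc] at b2 ⊢
    simp only [hf]
    rw [div_sub_div _ _ b1 b2, div_eq_div_iff b3 (mul_ne_zero b1 b2)]
    linear_combination (-contDen (gramCoeff ((k : ℝ) ^ 2)) (y + m + 1) k) * h2 +
      contNum (gramCoeff ((k : ℝ) ^ 2)) (y + m + 1) k * h1
  have hsum : ∀ m : ℕ, ∑ i ∈ Finset.range m, 1 / shiftedQuad ((k : ℝ) ^ 2) (y + (i : ℕ)) =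
      f y - f (y + m) := by
    intro m
    induction m with
    | zero => simp
    | succ m ih => rw [Finset.sum_range_succ, ih, hstep]; ring
  simp only [hsum]
  have h0 : Tendsto (fun m : ℕ => f (y + m)) atTop (𝓝 0) :=
    (tendsto_contNum_div_contDen _ k).comp (tendsto_add_natCast_atTop y)
  simpa using h0.const_sub (f y)

end Terminating

/-! ### The non-terminating case -/

section NonTerminating

variable {D : ℝ} {N : ℕ}

/-- The remainders `B_n F - A_n` of the continued fraction alternate in sign from `N` on. -/
def AlternatingRemainder (D : ℝ) (N : ℕ) (y F : ℝ) : Prop :=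
  ∀ n ≥ N, (contDen (gramCoeff D) y n * F - contNum (gramCoeff D) y n) *
    (contDen (gramCoeff D) y (n + 1) * F - contNum (gramCoeff D) y (n + 1)) < 0

lemma lt_natCast_sq_of_le {n : ℕ} (hN : D < (N : ℝ) ^ 2) (hn : N ≤ n) : D < (n : ℝ) ^ 2 :=
  hN.trans_le (by gcongr)

lemma AlternatingRemainder.backward (hN : D < (N : ℝ) ^ 2) {y F : ℝ} (hy : 0 < y)
    (hq : shiftedQuad D y ≠ 0) (h : AlternatingRemainder D N (y + 1) F) :
    AlternatingRemainder D N y (F + 1 / shiftedQuad D y) := by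
  have hback : ∀ n, shiftedQuad D y * (contDen (gramCoeff D) y n * (F + 1 / shiftedQuad D y) -
      contNum (gramCoeff D) y n) =
      backCoeff D y n *
        (contDen (gramCoeff D) (y + 1) n * F - contNum (gramCoeff D) (y + 1) n) -
      (2 * n + 1) *
        (contDen (gramCoeff D) (y + 1) (n + 1) * F - contNum (gramCoeff D) (y + 1) (n + 1)) := by
    intro n
    have h1 : shiftedQuad D y * (1 / shiftedQuad D y) = 1 := mul_one_div_cancel hq
    linear_combination F * shiftedQuad_mul_contDen D y n - shiftedQuad_mul_contNum D y n +
      contDen (gramCoeff D) y n * h1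
  -- The only possibly negative part, -D/4, exceeds -n²/4 and is absorbed by n(n+1)/2.
  have hH : ∀ n ≥ N, 0 < backCoeff D y n := by
    intro n hn
    have := lt_natCast_sq_of_le hN hn
    have h0 : (0 : ℝ) ≤ n := n.cast_nonneg
    rw [backCoeff]
    nlinarith [mul_nonneg h0 hy.le, sq_nonneg y, sq_nonneg (n : ℝ)]
  intro n hn
  have e1 := hback n
  have e2 := hback (n + 1)
  have a1 := h n hn
  have a2 := h (n + 1) (by omega)
  have p1 := hH n hn
  have p2 := hH (n + 1) (by omega)
  generalize contDen (gramCoeff D) (y + 1) n * F - contNum (gramCoeff D) (y + 1) n = r0 at *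
  generalize contDen (gramCoeff D) (y + 1) (n + 1) * F - contNum (gramCoeff D) (y + 1) (n + 1)
    = r1 at *
  generalize contDen (gramCoeff D) (y + 1) (n + 1 + 1) * F -
    contNum (gramCoeff D) (y + 1) (n + 1 + 1) = r2 at *
  generalize contDen (gramCoeff D) y n * (F + 1 / shiftedQuad D y) -
    contNum (gramCoeff D) y n = s0 at *
  generalize contDen (gramCoeff D) y (n + 1) * (F + 1 / shiftedQuad D y) -
    contNum (gramCoeff D) y (n + 1) = s1 at *
  generalize backCoeff D y n = H0 at *
  generalize backCoeff D y (n + 1) = H1 at *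
  push_cast at e2
  have hr : 0 < r0 * r2 := by
    have h3 := mul_pos_of_neg_of_neg a1 a2
    have h4 : r0 * r1 * (r1 * r2) = r1 ^ 2 * (r0 * r2) := by ring
    rw [h4] at h3
    exact pos_of_mul_pos_right h3 (sq_nonneg _)
  have h0 : (0 : ℝ) ≤ n := n.cast_nonneg
  -- Since r0 and r2 are both opposite in sign to r1, none of the four terms of the expanded product
  -- is positive, and the first and last are negative.
  have key : shiftedQuad D y ^ 2 * (s0 * s1) < 0 := by
    calc shiftedQuad D y ^ 2 * (s0 * s1) = (shiftedQuad D y * s0) * (shiftedQuad D y * s1) := by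
          ring
      _ = H0 * H1 * (r0 * r1) - H0 * (2 * (n + 1) + 1) * (r0 * r2) -
          (2 * n + 1) * H1 * r1 ^ 2 + (2 * n + 1) * (2 * (n + 1) + 1) * (r1 * r2) := by
          rw [e1, e2]; ring
      _ < 0 := by
        have t1 := mul_neg_of_pos_of_neg (mul_pos p1 p2) a1
        have t2 : 0 ≤ H0 * (2 * ((n : ℝ) + 1) + 1) * (r0 * r2) := by positivity
        have t3 : 0 ≤ (2 * (n : ℝ) + 1) * H1 * r1 ^ 2 := by positivity
        have t4 := mul_neg_of_pos_of_neg
          (by positivity : 0 < (2 * (n : ℝ) + 1) * (2 * ((n : ℝ) + 1) + 1)) a2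
        linarith
  exact neg_of_mul_neg_right key (sq_nonneg _)

lemma AlternatingRemainder.iterate_backward (hN : D < (N : ℝ) ^ 2) {y : ℝ} (hy : 0 < y)
    (hq : ∀ j : ℕ, shiftedQuad D (y + j) ≠ 0) (m : ℕ) {F : ℝ}
    (h : AlternatingRemainder D N (y + m) F) :
    AlternatingRemainder D N y
      (F + ∑ i ∈ Finset.range m, 1 / shiftedQuad D (y + (i : ℕ))) := by
  induction m generalizing F with
  | zero => simpa using h
  | succ m ih =>
    rw [Finset.sum_range_succ, add_comm (Finset.sum _ _), ← add_assoc]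
    refine ih (AlternatingRemainder.backward hN (by positivity) (hq m) ?_)
    push_cast at h
    rwa [← add_assoc] at h

/-- From index `N` on, the remainder is an alternating solution, hence negligible against the
independent solution B_n. In particular `F` is unique. -/
lemma AlternatingRemainder.tendsto (hN : D < (N : ℝ) ^ 2)
    (hD : ∀ n : ℕ, 1 ≤ n → (n : ℝ) ^ 2 ≠ D) {y F : ℝ} (hy : 0 < y)
    (h : AlternatingRemainder D N y F) :
    (∀ᶠ n in atTop, contDen (gramCoeff D) y n ≠ 0) ∧
      Tendsto (fun n => contNum (gramCoeff D) y n / contDen (gramCoeff D) y n) atTop (𝓝 F) := by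
  have hκ : ∀ m : ℕ, 0 < gramCoeff D (N + m + 1) := fun m =>
    gramCoeff_pos D (by omega) (lt_natCast_sq_of_le hN (by omega))
  have hbound : ∀ m : ℕ, gramCoeff D (N + m + 1) ≤ ((1 + |D|) * (N + 1) * (m + 1)) ^ 2 := by
    intro m
    refine (gramCoeff_le D (by omega)).trans ?_
    rw [mul_assoc (1 + |D|)]
    have h1 : ((N + m + 1 : ℕ) : ℝ) ≤ (N + 1) * (m + 1) := by
      push_cast
      nlinarith [mul_nonneg (N.cast_nonneg (α := ℝ)) (m.cast_nonneg (α := ℝ))]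
    gcongr
  have hmain := alternating_div_tendsto_zero (κ := fun m => gramCoeff D (N + m + 1)) (y := y)
    (c := (1 + |D|) * (N + 1)) hκ hy (by positivity) hbound
    (v := fun m => contDen (gramCoeff D) y (N + m) * F - contNum (gramCoeff D) y (N + m))
    (w := fun m => contDen (gramCoeff D) y (N + m))
    (fun m => by
      rw [show N + (m + 2) = N + m + 2 from rfl, contDen_add_two, contNum_add_two]
      simp only [← add_assoc]
      ring)
    (fun m => contDen_add_two _ _ (N + m)) (fun m => h (N + m) (by omega))
    (by
      have := neg_ne_zero.2 (contNum_mul_contDen_sub_ne_zero (gramCoeff D) y (n := N)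
        fun i hi _ => gramCoeff_ne_zero D hi (hD i hi))
      convert this using 1
      simp only [add_zero]
      ring)
  have hne : ∀ᶠ n in atTop, contDen (gramCoeff D) y n ≠ 0 := by
    obtain ⟨M, hM⟩ := eventually_atTop.1 hmain.1
    refine eventually_atTop.2 ⟨N + M, fun n hn => ?_⟩
    have := hM (n - N) (by omega)
    rwa [Nat.add_sub_cancel' (by omega)] at this
  refine ⟨hne, ?_⟩
  have hz : Tendsto (fun n => (contDen (gramCoeff D) y n * F - contNum (gramCoeff D) y n) /
      contDen (gramCoeff D) y n) atTop (𝓝 0) := by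
    refine (tendsto_add_atTop_iff_nat N).1 ?_
    simp only [add_comm _ N]
    exact hmain.2
  have hz' := hz.const_sub F
  rw [sub_zero] at hz'
  refine hz'.congr' (hne.mono fun n hn => ?_)
  field_simp
  ring

/-- `F` can be taken between the approximants of indices N and N + 1, which both tend to 0 as y → ∞.
-/
lemma eventually_exists_alternatingRemainder (hN : D < (N : ℝ) ^ 2)
    (hD : ∀ n : ℕ, 1 ≤ n → (n : ℝ) ^ 2 ≠ D) {ε : ℝ} (hε : 0 < ε) :
    ∀ᶠ y in atTop, ∃ F, |F| < ε ∧ AlternatingRemainder D N y F := by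
  have hsmall : ∀ n, ∀ᶠ y in atTop,
      |contNum (gramCoeff D) y n / contDen (gramCoeff D) y n| < ε := fun n => by
    have := Metric.tendsto_nhds.1 (tendsto_contNum_div_contDen (gramCoeff D) n) ε hε
    simpa only [Real.dist_eq, sub_zero] using this
  filter_upwards [eventually_gt_atTop 0, eventually_contDen_pos (gramCoeff D) N,
    eventually_contDen_pos (gramCoeff D) (N + 1), hsmall N, hsmall (N + 1)] with y hy h0 h1 s0 s1
  obtain ⟨F, hF, halt⟩ := exists_alternating (κ := fun m => gramCoeff D (N + m + 1)) (y := y)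
    (fun m => gramCoeff_pos D (by omega) (lt_natCast_sq_of_le hN (by omega))) hy
    (u := fun m => contNum (gramCoeff D) y (N + m)) (w := fun m => contDen (gramCoeff D) y (N + m))
    (fun m => contNum_add_two _ _ (N + m)) (fun m => contDen_add_two _ _ (N + m)) h0 h1
    (contNum_mul_contDen_sub_ne_zero (gramCoeff D) y (n := N)
        fun i hi _ => gramCoeff_ne_zero D hi (hD i hi))
  refine ⟨F, ?_, fun n hn => ?_⟩
  · have hsub : Set.uIcc (contNum (gramCoeff D) y N / contDen (gramCoeff D) y N)
        (contNum (gramCoeff D) y (N + 1) / contDen (gramCoeff D) y (N + 1)) ⊆ Set.Ioo (-ε) ε :=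
      Set.ordConnected_Ioo.uIcc_subset (abs_lt.1 s0) (abs_lt.1 s1)
    exact abs_lt.2 (hsub hF)
  · obtain ⟨m, rfl⟩ := Nat.exists_eq_add_of_le hn
    exact halt m

/-- If `D` is not the square of a positive integer and `y > 0`, the continued fraction converges
to the sum of the series. -/
lemma exists_tendsto_contNum_div_contDen (hD : ∀ n : ℕ, 1 ≤ n → (n : ℝ) ^ 2 ≠ D) {y : ℝ}
    (hy : 0 < y) (hq : ∀ j : ℕ, shiftedQuad D (y + j) ≠ 0) :
    ∃ L, (∀ᶠ n in atTop, contDen (gramCoeff D) y n ≠ 0) ∧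
      Tendsto (fun n => contNum (gramCoeff D) y n / contDen (gramCoeff D) y n) atTop (𝓝 L) ∧
      Tendsto (fun m => ∑ i ∈ Finset.range m, 1 / shiftedQuad D (y + (i : ℕ))) atTop (𝓝 L) := by
  obtain ⟨N, hN⟩ : ∃ N : ℕ, D < (N : ℝ) ^ 2 :=
    (((tendsto_pow_atTop two_ne_zero).comp tendsto_natCast_atTop_atTop).eventually_gt_atTop
      D).exists
  have hex : ∀ ε > 0, ∀ᶠ m : ℕ in atTop, ∃ F, |F| < ε ∧ AlternatingRemainder D N y
      (F + ∑ i ∈ Finset.range m, 1 / shiftedQuad D (y + (i : ℕ))) := fun ε hε =>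
    ((tendsto_add_natCast_atTop y).eventually
      (eventually_exists_alternatingRemainder hN hD hε)).mono
      fun m ⟨F, hF, h⟩ => ⟨F, hF, h.iterate_backward hN hy hq m⟩
  -- Any tolerance will do here: this only produces the limit, with which all other alternating
  -- values must then coincide.
  obtain ⟨m, F, -, hL⟩ := (hex 1 one_pos).exists
  have hlim := hL.tendsto hN hD hy
  refine ⟨_, hlim.1, hlim.2, Metric.tendsto_nhds.2 fun ε hε => ?_⟩
  filter_upwards [hex ε hε] with j ⟨G, hG, hj⟩
  rw [← tendsto_nhds_unique (hj.tendsto hN hD hy).2 hlim.2, Real.dist_eq, sub_add_cancel_right,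
    abs_neg]
  exact hG

end NonTerminating

/-! ### The series in terms of n₀, a, b, and the theorem -/

section Series

lemma seriesTerm_eq (a b : ℝ) (n₀ j : ℕ) :
    seriesTerm a b n₀ j =
      1 / shiftedQuad (a ^ 2 - 4 * b) ((n₀ : ℝ) + (a - 1) / 2 + (j : ℕ)) := by
  rw [seriesTerm, shiftedQuad]
  push_cast
  ring_nf

lemma summable_seriesTerm (a b : ℝ) (n₀ : ℕ) : Summable (seriesTerm a b n₀) := by
  have h : Summable fun n : ℕ => 1 / ((n : ℝ) ^ 2 + a * n + b) := by
    refine summable_of_isBigO_nat (Real.summable_one_div_nat_pow.2 one_lt_two)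
      (Asymptotics.IsBigO.of_bound 2 ?_)
    filter_upwards [eventually_ge_atTop 1, (tendsto_natCast_atTop_atTop (R := ℝ)).eventually_ge_atTop
      (2 * |a| + 2 * |b|)] with n hn1 hn
    have h1 : (1 : ℝ) ≤ n := by exact_mod_cast hn1
    have hlow : (n : ℝ) ^ 2 / 2 ≤ (n : ℝ) ^ 2 + a * n + b := by
      have ha := neg_abs_le a
      have hb := neg_abs_le b
      have h2 : (2 * |a| + 2 * |b|) * n ≤ n * n := by gcongr
      have h3 : |b| ≤ |b| * n := le_mul_of_one_le_right (abs_nonneg b) h1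
      have h4 : -|a| * n ≤ a * n := by gcongr
      nlinarith
    have hpos : 0 < (n : ℝ) ^ 2 / 2 := by positivity
    rw [Real.norm_of_nonneg (one_div_nonneg.2 (hpos.le.trans hlow)),
      Real.norm_of_nonneg (by positivity)]
    calc 1 / ((n : ℝ) ^ 2 + a * n + b) ≤ 1 / ((n : ℝ) ^ 2 / 2) := one_div_le_one_div_of_le hpos hlow
      _ = 2 * (1 / (n : ℝ) ^ 2) := by field_simp
  have h2 := (_root_.summable_nat_add_iff n₀).2 h
  refine h2.congr fun j => ?_
  rw [seriesTerm, add_comm j n₀]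

lemma tsum_seriesTerm_eq {a b : ℝ} {n₀ : ℕ} {L : ℝ}
    (h : Tendsto (fun m => ∑ i ∈ Finset.range m,
      1 / shiftedQuad (a ^ 2 - 4 * b) ((n₀ : ℝ) + (a - 1) / 2 + (i : ℕ))) atTop (𝓝 L)) :
    ∑' j : ℕ, seriesTerm a b n₀ j = L := by
  refine tendsto_nhds_unique (summable_seriesTerm a b n₀).hasSum.tendsto_sum_nat ?_
  simpa only [seriesTerm_eq] using h

lemma shiftedQuad_ne_zero_of_roots {a b : ℝ} {n₀ : ℕ}
    (h : ∀ α : ℤ, (α : ℝ) ^ 2 + a * (α : ℝ) + b = 0 → α < (n₀ : ℤ)) (j : ℕ) :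
    shiftedQuad (a ^ 2 - 4 * b) ((n₀ : ℝ) + (a - 1) / 2 + (j : ℕ)) ≠ 0 := by
  intro h0
  rw [shiftedQuad] at h0
  have := h ((n₀ + j : ℕ) : ℤ) (by push_cast; linarith)
  omega

lemma terminating_gram_fraction {a b : ℝ} {n₀ k : ℕ} (hk : 0 < k)
    (hD : a ^ 2 - 4 * b = (k : ℝ) ^ 2)
    (h : ∀ α : ℤ, (α : ℝ) ^ 2 + a * (α : ℝ) + b = 0 → α < (n₀ : ℤ)) :
    contDen (gramCoeff ((k : ℝ) ^ 2)) ((n₀ : ℝ) + (a - 1) / 2) k ≠ 0 ∧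
      ∑' j : ℕ, seriesTerm a b n₀ j =
        contNum (gramCoeff ((k : ℝ) ^ 2)) ((n₀ : ℝ) + (a - 1) / 2) k /
          contDen (gramCoeff ((k : ℝ) ^ 2)) ((n₀ : ℝ) + (a - 1) / 2) k := by
  have hq := shiftedQuad_ne_zero_of_roots h
  rw [hD] at hq
  refine ⟨contDen_self_ne_zero hk hq, tsum_seriesTerm_eq ?_⟩
  rw [hD]
  exact tendsto_sum_of_sq hk hq

lemma recipContFrac_gramCoeff_nums_dens (k : ℕ) (y : ℝ) :
    (recipContFrac (gramCoeff ((k : ℝ) ^ 2)) y).nums k = contNum (gramCoeff ((k : ℝ) ^ 2)) y k ∧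
      (recipContFrac (gramCoeff ((k : ℝ) ^ 2)) y).dens k =
        contDen (gramCoeff ((k : ℝ) ^ 2)) y k := by
  refine recipContFrac_nums_dens _ y (fun i h1 h2 => gramCoeff_ne_zero _ h1 fun h => ?_) k le_rfl
  have h3 : i ^ 2 = k ^ 2 := by exact_mod_cast h
  exact h2.ne (Nat.pow_left_injective two_ne_zero h3)

end Series

theorem theorem2 (a b : ℝ) :
    (∀ n₀ : ℕ,
      (∀ α : ℤ, (α : ℝ) ^ 2 + a * (α : ℝ) + b = 0 → α < (n₀ : ℤ)) →
      ((∃ k : ℕ, 0 < k ∧ Real.sqrt (a ^ 2 - 4 * b) = (k : ℝ)) ∨ (-a + 1) / 2 < (n₀ : ℝ)) →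
      Summable (seriesTerm a b n₀) ∧
        HasContFracValue (contFracF a b (n₀ : ℝ)) (∑' j : ℕ, seriesTerm a b n₀ j)) ∧
    (∀ k : ℕ, 0 < k → b = (a ^ 2 - (k : ℝ) ^ 2) / 4 →
      ∃ P Q : Polynomial ℝ, ∀ n₀ : ℕ,
        (∀ α : ℤ, ((α : ℝ) = (-a + (k : ℝ)) / 2 ∨ (α : ℝ) = (-a - (k : ℝ)) / 2) →
          α < (n₀ : ℤ)) →
        let g : GenContFract ℝ := recipContFrac
          (fun n : ℕ => (n : ℝ) ^ 2 * ((n : ℝ) ^ 2 - (k : ℝ) ^ 2) /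
            (4 * (2 * (n : ℝ) - 1) * (2 * (n : ℝ) + 1)))
          ((n₀ : ℝ) + (a - 1) / 2)
        Summable (seriesTerm a b n₀) ∧
          (g.dens k ≠ 0 ∧ ∑' j : ℕ, seriesTerm a b n₀ j = g.convs k) ∧
          (Q.eval (n₀ : ℝ) ≠ 0 ∧
            ∑' j : ℕ, seriesTerm a b n₀ j = P.eval (n₀ : ℝ) / Q.eval (n₀ : ℝ))) := by
  refine ⟨fun n₀ hroots hcase => ⟨summable_seriesTerm a b n₀, ?_⟩, fun k hk hb => ?_⟩
  · rw [contFracF, kappa_eq_gramCoeff, omegaShift]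
    -- The split is on termination; when D is not a positive square, the first alternative of
    -- `hcase` is impossible, and the second says y > 0.
    by_cases hsq : ∃ k : ℕ, 0 < k ∧ a ^ 2 - 4 * b = (k : ℝ) ^ 2
    · obtain ⟨k, hk, hD⟩ := hsq
      obtain ⟨hden, hsum⟩ := terminating_gram_fraction hk hD hroots
      obtain ⟨e1, e2⟩ := recipContFrac_gramCoeff_nums_dens k ((n₀ : ℝ) + (a - 1) / 2)
      have hterm := recipContFrac_terminatedAt (gramCoeff ((k : ℝ) ^ 2)) ((n₀ : ℝ) + (a - 1) / 2)
        hk (gramCoeff_sq_self k)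
      rw [hD]
      constructor
      · filter_upwards [eventually_ge_atTop k] with n hn
        rwa [GenContFract.dens_stable_of_terminated hn hterm, e2]
      · refine tendsto_const_nhds.congr' ?_
        filter_upwards [eventually_ge_atTop k] with n hn
        rw [GenContFract.convs_stable_of_terminated hn hterm, GenContFract.conv_eq_num_div_den,
          e1, e2, hsum]
    · have hD : ∀ n : ℕ, 1 ≤ n → (n : ℝ) ^ 2 ≠ a ^ 2 - 4 * b := fun n hn h => hsq ⟨n, hn, h.symm⟩
      have hy : 0 < (n₀ : ℝ) + (a - 1) / 2 := by
        rcases hcase with ⟨k, hk, hs⟩ | hlt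
        · have hk0 : (0 : ℝ) < k := by exact_mod_cast hk
          have hpos : 0 < a ^ 2 - 4 * b := Real.sqrt_pos.1 (hs ▸ hk0)
          exact absurd ⟨k, hk, by rw [← hs, Real.sq_sqrt hpos.le]⟩ hsq
        · linarith
      obtain ⟨L, hne, hlim, hsum⟩ :=
        exists_tendsto_contNum_div_contDen hD hy (shiftedQuad_ne_zero_of_roots hroots)
      have hcont := fun n => recipContFrac_nums_dens (gramCoeff (a ^ 2 - 4 * b))
        ((n₀ : ℝ) + (a - 1) / 2) (k := n) (fun i h1 _ => gramCoeff_ne_zero _ h1 (hD i h1)) n le_rfl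
      rw [tsum_seriesTerm_eq hsum]
      refine ⟨hne.mono fun n hn => by rwa [(hcont n).2], hlim.congr fun n => ?_⟩
      rw [GenContFract.conv_eq_num_div_den, (hcont n).1, (hcont n).2]
  · refine ⟨(numPoly (gramCoeff ((k : ℝ) ^ 2)) k).comp (.X + .C ((a - 1) / 2)),
      (denPoly (gramCoeff ((k : ℝ) ^ 2)) k).comp (.X + .C ((a - 1) / 2)), fun n₀ hroots => ?_⟩
    have hD : a ^ 2 - 4 * b = (k : ℝ) ^ 2 := by rw [hb]; ring
    obtain ⟨hden, hsum⟩ := terminating_gram_fraction (n₀ := n₀) hk hD fun α hα => hroots α <| by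
      have h : ((α : ℝ) - (-a + k) / 2) * ((α : ℝ) - (-a - k) / 2) = 0 := by
        rw [← hα, hb]
        ring
      exact (mul_eq_zero.1 h).imp sub_eq_zero.1 sub_eq_zero.1
    obtain ⟨e1, e2⟩ := recipContFrac_gramCoeff_nums_dens k ((n₀ : ℝ) + (a - 1) / 2)
    refine ⟨summable_seriesTerm a b n₀, ⟨e2.trans_ne hden, hsum.trans ?_⟩, ?_⟩
    · rw [← e1, ← e2]
      rfl
    · simpa [Polynomial.eval_comp, contNum, contDen] using And.intro hden hsum
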